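/- A non-adaptive measurement-based quantum computation (nMBQC) with $n$ parties on inputs $\mathbf x\in\mathbb Z_2^k$ consists of a unit vector $|\psi\rangle$ in a tensor product $\mathcal H_1\otimes\dots\otimes\mathcal H_n$ of complex Hilbert spaces of arbitrary (possibly infinite) dimension, of two POVMs $\{E^{s}_{j,0},E^{s}_{j,1}\}$, $s\in\mathbb Z_2$, for every party $j$, and of a matrix $P\in\mathbb Z_2^{n\times k}$ and a vector $\mathbf b\in\mathbb Z_2^n$, which describe the XOR and NOT gates of the control computer. On input $\mathbf x$, the control computer sends the bits $\mathbf s=P\mathbf x\oplus\mathbf b$ to the parties, every party $j$ measures once, with the POVM chosen by $s_j$, and the control computer outputs the parity of the outcomes $\mathbf m$; thus $p(\mathbf m\,|\,\mathbf s)=\langle\psi|\bigotimes_j E^{s_j}_{j,m_j}|\psi\rangle$. The computation performs $f:\mathbb Z_2^k\to\mathbb Z_2$ deterministically if its mean success probability $2^{-k}\sum_{\mathbf x}p\big(\bigoplus_j m_j=f(\mathbf x)\,\big|\,\mathbf x\big)$ equals $1$. A family $(f_k)_{k\ge 0}$ of functions $f_k:\mathbb Z_2^k\to\mathbb Z_2$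 is performed efficiently and deterministically in nMBQC if there is a polynomial $p$ such that for every $k$ the function $f_k$ is performed deterministically by an nMBQC with at most $p(k)$ parties. For $\varepsilon\ge 0$, a family $(f_k)$ is computable in quantum polynomial time with error at most $\varepsilon$ if a deterministic Turing machine produces in polynomial time, from each input $\mathbf x\in\mathbb Z_2^k$, the description of a quantum circuit of Hadamard, $\pi/8$ and controlled-NOT gates which, started in $|0\cdots0\rangle$, outputs $f_k(\mathbf x)$ (by a measurement of its first qubit) with probability at least $1-\varepsilon$. Universal quantum computation is achieved efficiently and deterministically in nMBQC, at error level $\varepsilon$, if every family that is computable in quantum polynomial time with error at most $\varepsilon$ is performed efficiently and deterministically in nMBQC. Let $\mathrm{NAND}_k(\mathbf x)=x_1x_2\cdots x_k\oplus 1$. Then the following hold. 1. The family $(\mathrm{NAND}_k)_{k\ge0}$ is computable by a deterministic Turing machine in polynomial time. 2. For all $k,n\ge 0$: if $\mathrm{NAND}_k$ can be performed deterministically in nMBQC with $n$ parties, then $n\ge 2^k-1$. 3. Consequently, it is impossible to achieve universal quantum computation efficiently and deterministically in nMBQC: for every $\varepsilon\ge0$ (in particular for $\varepsilon=1/3$,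 i.e. BQP, and even for $\varepsilon=0$, i.e. error-free quantum computation) there is a family that is computable in quantum polynomial time with error at most $\varepsilon$ and is not performed efficiently and deterministically in nMBQC. -/

import Mathlib

open scoped BigOperators ENNReal

universe u

noncomputable section

namespace NMBQC

/-! ### Hilbert spaces of the sites and local operators

Up to a unitary, an arbitrary complex Hilbert space (of finite or infinite dimension) is the space
of square-summable families indexed by an orthonormal basis, and the Hilbert tensor product of the
spaces with bases `ι j` is the space with basis `∀ j, ι j`. -/

/-- The Hilbert space with an orthonormal basis indexed by `ι`. -/
abbrev Hilb (ι : Type u) : Type u := lp (fun _ : ι => ℂ) 2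

section Local

variable {n : ℕ} {ι : Fin n → Type u}

theorem summable_sq {κ : Type u} (f : Hilb κ) : Summable fun a => ‖f a‖ ^ (2 : ℕ) := by
  have h := (memℓp_gen_iff (p := 2) (by norm_num)).1 f.2
  simpa using h

theorem norm_sq_eq {κ : Type u} (f : Hilb κ) : ‖f‖ ^ (2 : ℕ) = ∑' a, ‖f a‖ ^ (2 : ℕ) := by
  have h := lp.norm_rpow_eq_tsum (p := 2) (by norm_num) f
  simpa using h

theorem memlp_of_summable_sq {κ : Type u} {f : κ → ℂ}
    (h : Summable fun a => ‖f a‖ ^ (2 : ℕ)) : Memℓp f 2 := by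
  refine (memℓp_gen_iff (p := 2) (by norm_num)).2 ?_
  simpa using h

/-- The index families in which the coordinate of site `j` is split off. -/
def splitAt (ι : Fin n → Type u) (j : Fin n) :
    (∀ i, ι i) ≃ ι j × (∀ i : {i // i ≠ j}, ι i) := Equiv.piSplitAt j ι

theorem splitAt_update (j : Fin n) (a : ∀ i, ι i) (t : ι j) :
    Function.update a j t = (splitAt ι j).symm (t, (splitAt ι j a).2) := by
  apply (splitAt ι j).injective
  rw [Equiv.apply_symm_apply]
  refine Prod.ext ?_ ?_
  · simp [splitAt]
  · funext i
    simp [splitAt, Function.update_of_ne i.2]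

/-- The vector of site `j` obtained from a joint vector by fixing the basis indices of all other
sites to those of `a`. -/
def slice (j : Fin n) (f : Hilb (∀ i, ι i)) (a : ∀ i, ι i) : Hilb (ι j) :=
  ⟨fun t => f (Function.update a j t), memlp_of_summable_sq (by
    refine (summable_sq f).comp_injective (i := fun t : ι j => Function.update a j t) ?_
    exact Function.update_injective a j)⟩

theorem slice_symm (j : Fin n) (f : Hilb (∀ i, ι i)) (t t' : ι j)
    (r : ∀ i : {i // i ≠ j}, ι i) :
    slice j f ((splitAt ι j).symm (t, r)) = slice j f ((splitAt ι j).symm (t', r)) := by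
  apply lp.ext
  funext v
  simp [slice, splitAt_update]

theorem slice_add (j : Fin n) (f g : Hilb (∀ i, ι i)) (a : ∀ i, ι i) :
    slice j (f + g) a = slice j f a + slice j g a := rfl

theorem slice_smul (j : Fin n) (c : ℂ) (f : Hilb (∀ i, ι i)) (a : ∀ i, ι i) :
    slice j (c • f) a = c • slice j f a := rfl

/-- A bounded operator applied to all slices of a square-summable family. -/
theorem slices_bound {R T X : Type u} (e : R × T ≃ X) (A : Hilb T →L[ℂ] Hilb T) (f : Hilb X)
    (g : R → Hilb T) (hg : ∀ r t, g r t = f (e (r, t))) :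
    (Summable fun p : R × T => ‖A (g p.1) p.2‖ ^ (2 : ℕ)) ∧
      ∑' p : R × T, ‖A (g p.1) p.2‖ ^ (2 : ℕ) ≤ (‖A‖ * ‖f‖) ^ (2 : ℕ) := by
  have hfs : Summable fun p => ‖f (e p)‖ ^ (2 : ℕ) := (summable_sq f).comp_injective e.injective
  have hgn : ∀ r, ∑' t, ‖f (e (r, t))‖ ^ (2 : ℕ) = ‖g r‖ ^ (2 : ℕ) := by
    intro r
    rw [norm_sq_eq]
    exact tsum_congr fun t => by rw [hg]
  have hgs : Summable fun r => ‖g r‖ ^ (2 : ℕ) :=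
    (((summable_prod_of_nonneg (fun p => sq_nonneg _)).1 hfs).2).congr hgn
  have hle : ∀ r, ‖A (g r)‖ ^ (2 : ℕ) ≤ ‖A‖ ^ (2 : ℕ) * ‖g r‖ ^ (2 : ℕ) := by
    intro r
    rw [← mul_pow]
    exact pow_le_pow_left₀ (norm_nonneg _) (A.le_opNorm _) 2
  have hAs : Summable fun r => ‖A (g r)‖ ^ (2 : ℕ) :=
    Summable.of_nonneg_of_le (fun r => sq_nonneg _) hle (hgs.mul_left _)
  have hAn : ∀ r, ‖A (g r)‖ ^ (2 : ℕ) = ∑' t, ‖A (g r) t‖ ^ (2 : ℕ) := fun r => norm_sq_eq _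
  have hs : Summable fun p : R × T => ‖A (g p.1) p.2‖ ^ (2 : ℕ) :=
    (summable_prod_of_nonneg (fun p => sq_nonneg _)).2
      ⟨fun r => summable_sq (A (g r)), hAs.congr hAn⟩
  have hnf : ‖f‖ ^ (2 : ℕ) = ∑' r, ‖g r‖ ^ (2 : ℕ) := by
    rw [norm_sq_eq, ← e.tsum_eq, hfs.tsum_prod]
    exact tsum_congr hgn
  refine ⟨hs, ?_⟩
  rw [hs.tsum_prod, mul_pow, hnf, ← tsum_mul_left]
  refine Summable.tsum_le_tsum (fun r => ?_) (hAs.congr hAn) (hgs.mul_left _)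
  exact (hAn r).symm.le.trans (hle r)

/-- The bound `‖(A ⊗ 1) f‖ ≤ ‖A‖ ‖f‖`, in coordinates. -/
theorem siteOp_bound (j : Fin n) (A : Hilb (ι j) →L[ℂ] Hilb (ι j)) (f : Hilb (∀ i, ι i)) :
    (Summable fun a : ∀ i, ι i => ‖A (slice j f a) (a j)‖ ^ (2 : ℕ)) ∧
      ∑' a : ∀ i, ι i, ‖A (slice j f a) (a j)‖ ^ (2 : ℕ) ≤ (‖A‖ * ‖f‖) ^ (2 : ℕ) := by
  by_cases hne : Nonempty (ι j)
  swap
  · have : IsEmpty (∀ i, ι i) := ⟨fun a => hne ⟨a j⟩⟩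
    refine ⟨summable_empty, ?_⟩
    rw [tsum_empty]
    positivity
  obtain ⟨t₀⟩ := hne
  obtain ⟨e, he⟩ : ∃ e : (∀ i : {i // i ≠ j}, ι i) × ι j ≃ (∀ i, ι i),
      ∀ r t, e (r, t) = (splitAt ι j).symm (t, r) :=
    ⟨(Equiv.prodComm _ _).trans (splitAt ι j).symm, fun _ _ => rfl⟩
  have hj : ∀ (t : ι j) (r : ∀ i : {i // i ≠ j}, ι i), (splitAt ι j).symm (t, r) j = t := by
    intro t r
    exact congrArg Prod.fst ((splitAt ι j).apply_symm_apply (t, r))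
  obtain ⟨h1, h2⟩ := slices_bound e A f (fun r => slice j f ((splitAt ι j).symm (t₀, r))) (by
    intro r t
    simp [slice, splitAt_update, he])
  have hA : ∀ p : (∀ i : {i // i ≠ j}, ι i) × ι j,
      ‖A (slice j f (e p)) ((e p) j)‖ ^ (2 : ℕ) =
        ‖A (slice j f ((splitAt ι j).symm (t₀, p.1))) p.2‖ ^ (2 : ℕ) := by
    rintro ⟨r, t⟩
    rw [he, slice_symm j f t t₀ r, hj]
  constructor
  · rw [← e.summable_iff]
    exact h1.congr fun p => (hA p).symm
  · rw [← e.tsum_eq, tsum_congr hA]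
    exact h2

/-- The operator `1 ⊗ ⋯ ⊗ A ⊗ ⋯ ⊗ 1` on the joint Hilbert space: `A` acts on site `j` and the
identity on all other sites. -/
def siteOp (j : Fin n) (A : Hilb (ι j) →L[ℂ] Hilb (ι j)) :
    Hilb (∀ i, ι i) →L[ℂ] Hilb (∀ i, ι i) :=
  LinearMap.mkContinuous
    { toFun := fun f => ⟨fun a => A (slice j f a) (a j),
        memlp_of_summable_sq (siteOp_bound j A f).1⟩
      map_add' := fun f g => by
        apply lp.ext
        funext a
        change A (slice j (f + g) a) (a j) = A (slice j f a) (a j) + A (slice j g a) (a j)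
        rw [slice_add, map_add]
        rfl
      map_smul' := fun c f => by
        apply lp.ext
        funext a
        change A (slice j (c • f) a) (a j) = c • A (slice j f a) (a j)
        rw [slice_smul, map_smul]
        rfl }
    ‖A‖ (fun f => by
      refine le_of_sq_le_sq ?_ (by positivity)
      rw [norm_sq_eq]
      exact (siteOp_bound j A f).2)

/-- The tensor product `A₁ ⊗ ⋯ ⊗ Aₙ` of operators of the sites. -/
def tensorOp (A : ∀ j, Hilb (ι j) →L[ℂ] Hilb (ι j)) : Hilb (∀ i, ι i) →L[ℂ] Hilb (∀ i, ι i) :=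
  (List.ofFn fun j => siteOp j (A j)).prod

end Local

/-! ### Non-adaptive measurement-based quantum computing -/

/-- A non-adaptive measurement-based quantum computation with `n` sites on bit strings of
length `k`. -/
structure Protocol (k n : ℕ) where
  /-- the index set of an orthonormal basis of the Hilbert space of each site -/
  ι : Fin n → Type u
  /-- the `n`-partite state -/
  ψ : Hilb (∀ j, ι j)
  norm_ψ : ‖ψ‖ = 1
  /-- `E j s m` is the element for outcome `m` of the two-outcome measurement (POVM) that site `j`
  performs when it is sent the bit `s` -/
  E : ∀ j, ZMod 2 → ZMod 2 → (Hilb (ι j) →L[ℂ] Hilb (ι j))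
  E_pos : ∀ j s m, (E j s m).IsPositive
  E_sum : ∀ j s, ∑ m, E j s m = 1
  /-- the XOR gates (`P`) and NOT gates (`b`) with which the control computer produces the bits
  that it sends to the sites -/
  P : Matrix (Fin n) (Fin k) (ZMod 2)
  b : Fin n → ZMod 2

namespace Protocol

variable {k n : ℕ} (π : Protocol.{u} k n)

/-- The bits sent to the sites on input `x`. -/
def setting (x : Fin k → ZMod 2) : Fin n → ZMod 2 := π.P.mulVec x + π.b

/-- The probability `p(m | s)` of the outcomes `m` for the choice `s` of measurements. -/
def prob (m s : Fin n → ZMod 2) : ℝ :=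
  RCLike.re (inner ℂ π.ψ (tensorOp (fun j => π.E j (s j) (m j)) π.ψ))

/-- The probability that the parity of the outcomes is `c` on input `x`. -/
def outputProb (x : Fin k → ZMod 2) (c : ZMod 2) : ℝ :=
  ∑ m : Fin n → ZMod 2 with ∑ j, m j = c, π.prob m (π.setting x)

/-- The mean probability, over a uniformly random input, that the parity of the outcomes
is `f x`. -/
def meanSuccess (f : (Fin k → ZMod 2) → ZMod 2) : ℝ :=
  1 / 2 ^ k * ∑ x : Fin k → ZMod 2, π.outputProb x (f x)

end Protocol

/-- The Boolean function `f` can be performed deterministically with `n` sites. -/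
def Performs (n : ℕ) {k : ℕ} (f : (Fin k → ZMod 2) → ZMod 2) : Prop :=
  ∃ π : Protocol.{u} k n, π.meanSuccess f = 1

/-- A Boolean function on bit strings of every length. -/
abbrev BoolFamily : Type := ∀ k : ℕ, (Fin k → ZMod 2) → ZMod 2

/-- The family `f` can be performed deterministically and efficiently: for every length `k` the
number of sites is bounded by a polynomial in `k`. -/
def PerformsEfficiently (f : BoolFamily) : Prop :=
  ∃ p : Polynomial ℕ, ∀ k, ∃ n ≤ p.eval k, Performs.{u} n (f k)

/-- The NAND function `x ↦ x₁ ⋯ x_k ⊕ 1`. -/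
def nand : BoolFamily := fun _ x => (∏ j, x j) + 1

/-! ### Classical and quantum polynomial time -/

/-- Bit strings of arbitrary length. -/
abbrev BitString : Type := Σ k : ℕ, (Fin k → ZMod 2)

/-- A bit string as a word over the alphabet `ZMod 2`. -/
def BitString.word (x : BitString) : List (ZMod 2) := List.ofFn x.2

/-- The family `f` is computed by a deterministic Turing machine in polynomial time. -/
def ClassicalPolyTime (f : BoolFamily) : Prop :=
  Nonempty (Turing.TM2ComputableInPolyTime BitString.word (fun c : ZMod 2 => [c])
    (fun x : BitString => f x.1 x.2))

/-- Elementary gates on `w` qubits: Hadamard gates, `π/8` gates and controlled-NOT gates. -/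
inductive Gate (w : ℕ) : Type
  | had (q : Fin w)
  | tee (q : Fin w)
  | cnot (c t : Fin w) (h : c ≠ t)

/-- Amplitudes of `w` qubits in the computational basis. -/
abbrev QState (w : ℕ) : Type := (Fin w → ZMod 2) → ℂ

/-- The action of a gate on amplitudes: `|0⟩ ↦ (|0⟩ + |1⟩)/√2`, `|1⟩ ↦ (|0⟩ - |1⟩)/√2` for the
Hadamard gate, `|1⟩ ↦ exp(iπ/4)|1⟩` for the `π/8` gate, `|c, t⟩ ↦ |c, t ⊕ c⟩` for the
controlled-NOT gate. -/
def Gate.apply {w : ℕ} : Gate w → QState w → QState w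
  | .had q, φ => fun a => (1 / (Real.sqrt 2 : ℂ)) *
      (φ (Function.update a q 0) + (if a q = 1 then -1 else 1) * φ (Function.update a q 1))
  | .tee q, φ => fun a => (if a q = 1 then Complex.exp (Complex.I * (Real.pi / 4)) else 1) * φ a
  | .cnot c t _, φ => fun a => φ (Function.update a t (a t + a c))

/-- A quantum circuit without input: a number `extra + 1` of qubits and a list of gates that are
applied one after the other, the head of the list first. -/
structure QCircuit : Type where
  extra : ℕ
  gates : List (Gate (extra + 1))

/-- The state of the circuit after all gates, started in `|0 ⋯ 0⟩`. -/
def QCircuit.final (C : QCircuit) : QState (C.extra + 1) :=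
  C.gates.foldl (fun φ g => g.apply φ) (fun a => if a = 0 then 1 else 0)

/-- The probability that a measurement of the first qubit at the end gives `c`. -/
def QCircuit.outputProb (C : QCircuit) (c : ZMod 2) : ℝ :=
  ∑ a : Fin (C.extra + 1) → ZMod 2 with a 0 = c, ‖C.final a‖ ^ 2

/-- The alphabet for descriptions of circuits. -/
inductive Sym : Type
  | tick | had | tee | cnot | sep

/-- A number in unary. -/
def ticks (n : ℕ) : List Sym := List.replicate n Sym.tick

/-- The description of a gate. -/
def Gate.encode {w : ℕ} : Gate w → List Sym
  | .had q => Sym.had :: ticks q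
  | .tee q => Sym.tee :: ticks q
  | .cnot c t _ => Sym.cnot :: (ticks c ++ Sym.sep :: ticks t)

/-- The description of a circuit. -/
def QCircuit.encode (C : QCircuit) : List Sym :=
  ticks C.extra ++ C.gates.flatMap Gate.encode

theorem ticks_append_inj {a b : ℕ} {l l' : List Sym} (hl : l.head? ≠ some Sym.tick)
    (hl' : l'.head? ≠ some Sym.tick) (h : ticks a ++ l = ticks b ++ l') : a = b ∧ l = l' := by
  induction a generalizing b with
  | zero =>
    cases b with
    | zero => exact ⟨rfl, h⟩
    | succ b =>
      have h' : l = Sym.tick :: (ticks b ++ l') := h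
      rw [h'] at hl
      exact absurd rfl hl
  | succ a ih =>
    cases b with
    | zero =>
      have h' : Sym.tick :: (ticks a ++ l) = l' := h
      rw [← h'] at hl'
      exact absurd rfl hl'
    | succ b =>
      have h' : Sym.tick :: (ticks a ++ l) = Sym.tick :: (ticks b ++ l') := h
      obtain ⟨h1, h2⟩ := ih (List.cons.inj h').2
      exact ⟨by rw [h1], h2⟩

theorem gates_head {w : ℕ} (L : List (Gate w)) :
    (L.flatMap Gate.encode).head? ≠ some Sym.tick := by
  rcases L with _ | ⟨g, L⟩
  · simp
  · cases g <;> simp [Gate.encode]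

theorem gates_encode_injective {w : ℕ} :
    Function.Injective fun L : List (Gate w) => L.flatMap Gate.encode := by
  intro L
  induction L with
  | nil =>
    intro L' h
    rcases L' with _ | ⟨g, L'⟩
    · rfl
    · cases g <;> simp [Gate.encode] at h
  | cons g L ih =>
    intro L' h
    rcases L' with _ | ⟨g', L'⟩
    · cases g <;> simp [Gate.encode] at h
    · cases g <;> cases g' <;>
        simp only [Gate.encode, List.flatMap_cons, List.cons_append, List.append_assoc,
          List.cons.injEq, reduceCtorEq, false_and, true_and] at h
      · obtain ⟨h1, h2⟩ := ticks_append_inj (gates_head _) (gates_head _) h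
        rw [Fin.ext h1, ih h2]
      · obtain ⟨h1, h2⟩ := ticks_append_inj (gates_head _) (gates_head _) h
        rw [Fin.ext h1, ih h2]
      · obtain ⟨h1, h2⟩ := ticks_append_inj (by simp) (by simp) h
        obtain ⟨h3, h4⟩ := ticks_append_inj (gates_head _) (gates_head _) (List.cons.inj h2).2
        obtain rfl := Fin.ext h1
        obtain rfl := Fin.ext h3
        rw [ih h4]

/-- Different circuits have different descriptions. -/
theorem QCircuit.encode_injective : Function.Injective QCircuit.encode := by
  rintro ⟨m, L⟩ ⟨m', L'⟩ h
  obtain ⟨h1, h2⟩ := ticks_append_inj (gates_head _) (gates_head _) h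
  obtain rfl : m = m' := h1
  obtain rfl : L = L' := gates_encode_injective h2
  rfl

/-- The family `f` is computed in quantum polynomial time with error probability at most `ε`: a
deterministic Turing machine produces in polynomial time, from the input `x`, the description of a
quantum circuit whose output is `f x` with probability at least `1 - ε`. -/
def QuantumPolyTime (ε : ℝ) (f : BoolFamily) : Prop :=
  ∃ C : BitString → QCircuit,
    Nonempty (Turing.TM2ComputableInPolyTime BitString.word QCircuit.encode C) ∧
    ∀ x : BitString, 1 - ε ≤ (C x).outputProb (f x.1 x.2)

/-- Universal quantum computation is achieved efficiently and deterministically by non-adaptive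
measurement-based quantum computing: whatever a quantum computer computes in polynomial time with
error probability at most `ε` can be performed deterministically with polynomially many sites. -/
def Universal (ε : ℝ) : Prop :=
  ∀ f : BoolFamily, QuantumPolyTime ε f → PerformsEfficiently.{u} f

end NMBQC

end

/-! Determinism makes the state ψ a common eigenvector: if A_j(x) is the observable E₀ − E₁ of site
j on input x, then J(x) = ∏_j A_j(x) satisfies J(x)ψ = (−1)^{f(x)} ψ (`joint_apply`). The A_j(x) are
only symmetric contractions, but since J(x) preserves the norm of ψ, they act as involutions on the
orbit of ψ under the operators of one site (`exists_perm`). So group relations are available site by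
site.

Let f have odd weight, and suppose that some q ≠ 0 is not a row of P. Choose v with q·v = 1 and
multiply J(x)J(x+v) over all x in ker q. Every input occurs once, so ψ acquires the sign (−1)^{∑f} =
−1. Site j contributes the pairs A_j(x)A_j(x+v). They are trivial if P_j·v = 0. Otherwise they are
(r₀r₁)^{±1}, where r_t is the involution for the bit t, and the exponents cancel because P_j ≠ q is
balanced on ker q (`alternating_prod_eq_one`, `balanced_on_ker`). So the same product fixes ψ, a
contradiction (`exists_row`).

Hence all 2^k − 1 nonzero vectors are rows of P whenever the weight is odd, as it is for NAND with k
≥ 1. No polynomial bounds 2^k − 1. For the quantum side, the Turing machine evaluates NAND itself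
and emits a circuit with constant output. -/

noncomputable section

namespace NMBQC

/-! ### Commuting contractions with a common eigenvector -/

section Commuting

variable {H : Type*} [NormedAddCommGroup H] [InnerProductSpace ℂ H]

/-- The operators that do not increase norms. -/
def contractions (H : Type*) [NormedAddCommGroup H] [InnerProductSpace ℂ H] :
    Submonoid (H →L[ℂ] H) where
  carrier := {T | ∀ φ, ‖T φ‖ ≤ ‖φ‖}
  one_mem' := fun _ => le_rfl
  mul_mem' := fun {_ _} hS hT φ => (hS _).trans (hT φ)

/-- The operators that fix a vector. -/
def fixing (ψ : H) : Submonoid (H →L[ℂ] H) where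
  carrier := {T | T ψ = ψ}
  one_mem' := rfl
  mul_mem' := fun {S T} hS hT => by
    change S (T ψ) = ψ
    rw [show T ψ = ψ from hT, show S ψ = ψ from hS]

/-- Symmetry turns the cross term of ‖T²φ − φ‖² into −2‖Tφ‖² = −2‖φ‖², and contractivity bounds the
two squares by ‖φ‖² each. -/
theorem apply_apply_of_norm_eq {T : H →L[ℂ] H} (hT : T ∈ contractions H)
    (hs : T.toLinearMap.IsSymmetric) {φ : H} (h : ‖T φ‖ = ‖φ‖) : T (T φ) = φ := by
  have h1 : ‖T (T φ) - φ‖ ^ 2 = ‖T (T φ)‖ ^ 2 - 2 * ‖T φ‖ ^ 2 + ‖φ‖ ^ 2 := by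
    rw [@norm_sub_sq ℂ]
    have h2 : inner ℂ (T (T φ)) φ = inner ℂ (T φ) (T φ) := hs (T φ) φ
    rw [h2, inner_self_eq_norm_sq]
  have h3 : ‖T (T φ)‖ ^ 2 ≤ ‖φ‖ ^ 2 :=
    pow_le_pow_left₀ (norm_nonneg _) ((hT _).trans (hT _)) 2
  have h4 : ‖T (T φ) - φ‖ ^ 2 ≤ 0 := by rw [h1, h]; linarith
  have h5 : ‖T (T φ) - φ‖ = 0 := by
    have := le_antisymm h4 (sq_nonneg _)
    exact pow_eq_zero_iff (two_ne_zero) |>.1 this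
  exact sub_eq_zero.1 (norm_eq_zero.1 h5)

variable {ι X : Type*}

/-- Families of symmetric contractions of the sites `ι`, those of different sites commuting. -/
structure SiteFamily (H : Type*) [NormedAddCommGroup H] [InnerProductSpace ℂ H]
    (ι X : Type*) where
  op : ι → X → (H →L[ℂ] H)
  contraction : ∀ j x, op j x ∈ contractions H
  symmetric : ∀ j x, (op j x).toLinearMap.IsSymmetric
  comm : ∀ i j, i ≠ j → ∀ x y, Commute (op i x) (op j y)

namespace SiteFamily

variable (a : SiteFamily H ι X)

/-- The product of the operators of a site along a list. -/
def word (j : ι) (l : List X) : H →L[ℂ] H := (l.map (a.op j)).prod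

theorem word_cons (j : ι) (x : X) (l : List X) : a.word j (x :: l) = a.op j x * a.word j l := by
  simp [word]

theorem commute_word {i j : ι} (hij : i ≠ j) (x : X) (l : List X) :
    Commute (a.op i x) (a.word j l) := by
  refine Commute.list_prod_right _ _ fun T hT => ?_
  obtain ⟨y, -, rfl⟩ := List.mem_map.1 hT
  exact a.comm i j hij x y

theorem commute_words {i j : ι} (hij : i ≠ j) (l l' : List X) :
    Commute (a.word i l) (a.word j l') := by
  refine Commute.list_prod_left _ _ fun T hT => ?_
  obtain ⟨y, -, rfl⟩ := List.mem_map.1 hT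
  exact a.commute_word hij y l'

/-- Transfers relations from the permutation group of an orbit back to operators applied to its
vectors. -/
theorem word_eq_of_perm {a : SiteFamily H ι X} {j : ι} {O : Set H} {b : X → Equiv.Perm O}
    (hb : ∀ x o, (b x o : H) = a.op j x o) (l : List X) (o : O) :
    ((l.map b).prod o : H) = a.word j l o := by
  induction l with
  | nil => simp [word]
  | cons x l ih =>
    rw [word_cons, List.map_cons, List.prod_cons, Equiv.Perm.mul_apply, hb, ih]
    rfl

variable [Fintype ι]

/-- The product over all sites of the words along a list. -/
def total (l : List X) : H →L[ℂ] H :=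
  Finset.univ.noncommProd (fun j => a.word j l) fun _ _ _ _ hij => a.commute_words hij l l

/-- The product of the operators of all sites. -/
def joint (x : X) : H →L[ℂ] H :=
  Finset.univ.noncommProd (fun j => a.op j x) fun i _ j _ hij => a.comm i j hij x x

theorem total_cons (x : X) (l : List X) : a.total (x :: l) = a.joint x * a.total l := by
  exact (Finset.noncommProd_congr rfl (fun j _ => a.word_cons j x l) _).trans
    (Finset.noncommProd_mul_distrib (fun j => a.op j x) (fun j => a.word j l) _ _
      fun i _ j _ hij => (a.commute_word hij.symm x l).symm)

/-- The same product read in two ways, site by site and input by input; the contradiction in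
`exists_row` compares these readings. -/
theorem total_eq (l : List X) : a.total l = (l.map a.joint).prod := by
  induction l with
  | nil =>
    -- Lying in the trivial submonoid means being equal to 1.
    refine Submonoid.noncommProd_mem ⊥ _ _ _ fun j _ => ?_
    simp [word]
  | cons x l ih => rw [total_cons, ih, List.map_cons, List.prod_cons]

theorem total_fix {ψ : H} {l : List X} (h : ∀ j, a.word j l ψ = ψ) : a.total l ψ = ψ :=
  Submonoid.noncommProd_mem (fixing ψ) _ _ _ fun j _ => h j

/-- The joint operator is the operator of one site times a contraction that commutes with all
operators of this site. -/
theorem joint_split (j : ι) (x : X) : ∃ B ∈ contractions H,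
    (∀ y, Commute B (a.op j y)) ∧ a.joint x = a.op j x * B := by
  classical
  refine ⟨(Finset.univ.erase j).noncommProd (fun i => a.op i x)
    (fun i _ k _ hik => a.comm i k hik x x), ?_, ?_, ?_⟩
  · exact Submonoid.noncommProd_mem _ _ _ _ fun i _ => a.contraction i x
  · intro y
    refine (Finset.noncommProd_commute _ _ _ _ fun i hi => ?_).symm
    exact a.comm j i (Finset.ne_of_mem_erase hi).symm y x
  · exact (Finset.mul_noncommProd_erase _ (Finset.mem_univ j) (fun i => a.op i x) _).symm

theorem joint_mem (x : X) : a.joint x ∈ contractions H :=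
  Submonoid.noncommProd_mem _ _ _ _ fun i _ => a.contraction i x

/-! ### Action of a single site on a joint eigenvector -/

variable {a} {ψ : H} {c : X → ℂ}

/-- K collects the factors of the other sites. It commutes past the operators of site j, so it
completes the word to a product of joint operators, which are scalars on ψ. -/
theorem exists_completion (hψ : ∀ x, a.joint x ψ = c x • ψ) (j : ι) (l : List X) :
    ∃ K ∈ contractions H, (∀ y, Commute K (a.op j y)) ∧
      K (a.word j l ψ) = (l.map c).prod • ψ := by
  induction l with
  | nil => exact ⟨1, one_mem _, fun y => Commute.one_left _, by simp [word]⟩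
  | cons x l ih =>
    obtain ⟨K, hK, hKc, hKψ⟩ := ih
    obtain ⟨B, hB, hBc, hBj⟩ := a.joint_split j x
    refine ⟨B * K, mul_mem hB hK, fun y => (hBc y).mul_left (hKc y), ?_⟩
    have h1 : B * K * a.word j (x :: l) = a.joint x * (K * a.word j l) := by
      rw [a.word_cons, hBj, ← mul_assoc, mul_assoc B K, (hKc x).eq, ← mul_assoc, (hBc x).eq,
        mul_assoc, mul_assoc]
    have h2 := congrArg (fun T : H →L[ℂ] H => T ψ) h1
    simp only [mul_apply_eq_comp] at h2
    rw [mul_apply_eq_comp, h2, hKψ, map_smul, hψ, List.map_cons, List.prod_cons,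
      smul_smul, mul_comm]

/-- The word cannot increase the norm, and it cannot decrease it either: the contraction K of
`exists_completion` sends the result to a unimodular multiple of ψ. -/
theorem norm_word (hψ : ∀ x, a.joint x ψ = c x • ψ) (hc : ∀ x, ‖c x‖ = 1) (j : ι) (l : List X) :
    ‖a.word j l ψ‖ = ‖ψ‖ := by
  apply le_antisymm
  · refine (Submonoid.list_prod_mem (contractions H) fun T hT => ?_ :
      a.word j l ∈ contractions H) ψ
    obtain ⟨y, -, rfl⟩ := List.mem_map.1 hT
    exact a.contraction j y
  · obtain ⟨K, hK, -, hKψ⟩ := exists_completion hψ j l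
    have h1 : ‖(l.map c).prod‖ = 1 :=
      (Submonoid.list_prod_mem (Submonoid.unitSphere ℂ) (l := l.map c) fun z hz => by
        obtain ⟨y, -, rfl⟩ := List.mem_map.1 hz
        exact mem_sphere_zero_iff_norm.2 (hc y) : (l.map c).prod ∈ Submonoid.unitSphere ℂ)
          |> mem_sphere_zero_iff_norm.1
    calc ‖ψ‖ = ‖K (a.word j l ψ)‖ := by rw [hKψ, norm_smul, h1, one_mul]
      _ ≤ _ := hK _

theorem op_op_word (hψ : ∀ x, a.joint x ψ = c x • ψ) (hc : ∀ x, ‖c x‖ = 1) (j : ι) (x : X)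
    (l : List X) : a.op j x (a.op j x (a.word j l ψ)) = a.word j l ψ := by
  refine apply_apply_of_norm_eq (a.contraction j x) (a.symmetric j x) ?_
  rw [norm_word hψ hc, ← norm_word hψ hc j (x :: l), word_cons]
  rfl

/-- The operators of a site act on the orbit of the eigenvector by involutions. -/
theorem exists_perm (hψ : ∀ x, a.joint x ψ = c x • ψ) (hc : ∀ x, ‖c x‖ = 1) (j : ι) :
    ∃ (O : Set H) (b : X → Equiv.Perm O), ψ ∈ O ∧ (∀ x o, (b x o : H) = a.op j x o) ∧
      ∀ x, b x * b x = 1 := by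
  -- The operators need not be invertible on all of H, since the measurements need not be
  -- projective. On this orbit they square to the identity.
  let O : Set H := Set.range fun l => a.word j l ψ
  have hO : ∀ x, ∀ φ ∈ O, a.op j x φ ∈ O := by
    rintro x _ ⟨l, rfl⟩
    exact ⟨x :: l, by simp only [word_cons]; rfl⟩
  have hinv : ∀ x, Function.Involutive fun o : O => (⟨a.op j x o, hO x o o.2⟩ : O) := by
    rintro x ⟨_, l, rfl⟩
    exact Subtype.ext (op_op_word hψ hc j x l)
  refine ⟨O, fun x => (hinv x).toPerm, ⟨[], by simp [word]⟩, fun x o => rfl, fun x => ?_⟩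
  ext1 o
  exact hinv x o

end SiteFamily

end Commuting

/-! ### Words in involutions -/

/-- If an involution depends only on the value of an affine functional, a balanced alternating
product is trivial. -/
theorem alternating_prod_eq_one {G : Type*} [Group G] {X : Type*} [AddCommGroup X]
    (b : X → G) (hb : ∀ x, b x * b x = 1) (s : X → ZMod 2) (hs : ∀ x y, s x = s y → b x = b y)
    (p : X →+ ZMod 2) (hp : ∀ x, s x = p x + s 0) (v : X) (l : List X)
    (hl : p v ≠ 0 → (l.map fun x => (1 - 2 * ((s x).val : ℤ))).sum = 0) :
    ((l.flatMap fun x => [x, x + v]).map b).prod = 1 := by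
  have hflat : ∀ l : List X, ((l.flatMap fun x => [x, x + v]).map b).prod =
      (l.map fun x => b x * b (x + v)).prod := by
    intro l
    induction l with
    | nil => rfl
    | cons x l ih => simp [ih, mul_assoc]
  rw [hflat]
  by_cases hv : p v = 0
  · apply List.prod_eq_one
    intro g hg
    obtain ⟨x, -, rfl⟩ := List.mem_map.1 hg
    rw [hs (x + v) x (by rw [hp (x + v), hp x, map_add, hv, add_zero]), hb]
  have two : ∀ z : ZMod 2, z = 0 ∨ z = 1 := by decide
  have hv1 : p v = 1 := (two _).resolve_left hv
  -- At most two involutions occur. Since s v = s 0 + 1, the points 0 and v represent both values of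
  -- s.
  let r : ZMod 2 → G := fun t => if t = s 0 then b 0 else b v
  have hbr : ∀ x, b x = r (s x) := by
    intro x
    by_cases hx : s x = s 0
    · simp only [r, if_pos hx]
      exact hs _ _ hx
    · simp only [r, if_neg hx]
      refine hs _ _ ?_
      have := hp v
      rw [hv1] at this
      rw [this]
      have key : ∀ y z : ZMod 2, y ≠ z → y = 1 + z := by decide
      exact key _ _ hx
  have hr : ∀ t, r t * r t = 1 := by
    intro t
    by_cases ht : t = s 0 <;> simp [r, ht, hb]
  -- Moving by v flips the bit, so the pair is r 0 * r 1 or r 1 * r 0, which are mutually inverse.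
  -- All pairs are powers of one element.
  have hpair : ∀ x, b x * b (x + v) = (r 0 * r 1) ^ (1 - 2 * ((s x).val : ℤ)) := by
    intro x
    have hxv : s (x + v) = s x + 1 := by
      rw [hp (x + v), hp x, map_add, hv1]; ring
    rw [hbr x, hbr (x + v), hxv]
    rcases two (s x) with h | h
    · simp [h]
    · rw [h]
      have h0 : (1 : ZMod 2) + 1 = 0 := by decide
      have h1 : ((1 : ZMod 2).val : ℤ) = 1 := by decide
      rw [h0, h1]
      norm_num
      rw [inv_eq_of_mul_eq_one_right (hr 0), inv_eq_of_mul_eq_one_right (hr 1)]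
  have hsum : ∀ l : List X, (l.map fun x => b x * b (x + v)).prod =
      (r 0 * r 1) ^ (l.map fun x => (1 - 2 * ((s x).val : ℤ))).sum := by
    intro l
    induction l with
    | nil => simp
    | cons x l ih => rw [List.map_cons, List.prod_cons, ih, hpair, List.map_cons, List.sum_cons,
        zpow_add]
  rw [hsum, hl hv, zpow_zero]

/-! ### Operators of single sites -/

section Local

variable {n : ℕ} {ι : Fin n → Type u}

theorem siteOp_apply (j : Fin n) (A : Hilb (ι j) →L[ℂ] Hilb (ι j)) (f : Hilb (∀ i, ι i))
    (a : ∀ i, ι i) : siteOp j A f a = A (slice j f a) (a j) := rfl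

theorem norm_siteOp_le (j : Fin n) (A : Hilb (ι j) →L[ℂ] Hilb (ι j)) : ‖siteOp j A‖ ≤ ‖A‖ :=
  LinearMap.mkContinuous_norm_le _ (norm_nonneg _) _

theorem siteOp_add (j : Fin n) (A B : Hilb (ι j) →L[ℂ] Hilb (ι j)) :
    siteOp j (A + B) = siteOp j A + siteOp j B := rfl

theorem siteOp_one (j : Fin n) : siteOp j (1 : Hilb (ι j) →L[ℂ] Hilb (ι j)) = 1 := by
  ext f a
  change f (Function.update a j (a j)) = f a
  rw [Function.update_eq_self]

theorem hilb_ext {κ : Type u} {f g : Hilb κ} (h : ∀ a, f a = g a) : f = g := lp.ext (funext h)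

theorem single_one_apply {κ : Type u} [DecidableEq κ] (c a : κ) :
    (lp.single 2 c 1 : Hilb κ) a = if a = c then 1 else 0 := by
  rw [lp.single_apply, Pi.single_apply]

theorem ext_basis {κ : Type u} [DecidableEq κ] {F : Type*} [NormedAddCommGroup F]
    [NormedSpace ℂ F] {S T : Hilb κ →L[ℂ] F}
    (h : ∀ c, S (lp.single 2 c 1) = T (lp.single 2 c 1)) : S = T := by
  ext f
  have hf : HasSum (fun c => lp.single 2 c (f c)) f := lp.hasSum_single (by norm_num) f
  have h1 : ∀ c, lp.single 2 c (f c) = f c • (lp.single 2 c 1 : Hilb κ) := by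
    intro c
    rw [← lp.single_smul, smul_eq_mul, mul_one]
  have hS := hf.mapL S
  have hT := hf.mapL T
  simp only [h1, map_smul, h] at hS hT
  exact hS.unique hT

theorem slice_single [∀ i, DecidableEq (ι i)] (j : Fin n) (c a : ∀ i, ι i) :
    slice j (lp.single 2 c 1) a =
      if ∀ i, i ≠ j → a i = c i then lp.single 2 (c j) 1 else 0 := by
  refine hilb_ext fun t => ?_
  change (lp.single 2 c (1 : ℂ) : Hilb (∀ i, ι i)) (Function.update a j t) = _
  have e := Function.update_eq_iff (f := a) (a := j) (b := t) (g := c)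
  rw [single_one_apply]
  by_cases h : ∀ i, i ≠ j → a i = c i
  · rw [if_pos h, single_one_apply]
    exact if_congr ⟨fun h' => (e.1 h').1, fun h' => e.2 ⟨h', h⟩⟩ rfl rfl
  · rw [if_neg h, if_neg (fun h' => h (e.1 h').2)]
    rfl

theorem siteOp_single [∀ i, DecidableEq (ι i)] (j : Fin n) (A : Hilb (ι j) →L[ℂ] Hilb (ι j))
    (c a : ∀ i, ι i) :
    siteOp j A (lp.single 2 c 1) a =
      if ∀ i, i ≠ j → a i = c i then A (lp.single 2 (c j) 1) (a j) else 0 := by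
  rw [siteOp_apply, slice_single]
  split_ifs
  · rfl
  · rw [map_zero]; rfl

/-- The matrix entries factor into one entry per site, an expression symmetric in the two sites;
`siteOp_commute` follows by comparing entries. -/
theorem siteOp_siteOp_single [∀ i, DecidableEq (ι i)] {i j : Fin n} (hij : i ≠ j)
    (A : Hilb (ι i) →L[ℂ] Hilb (ι i))
    (B : Hilb (ι j) →L[ℂ] Hilb (ι j)) (c a : ∀ i, ι i) :
    siteOp i A (siteOp j B (lp.single 2 c 1)) a =
      if ∀ l, l ≠ i → l ≠ j → a l = c l then
        A (lp.single 2 (c i) 1) (a i) * B (lp.single 2 (c j) 1) (a j) else 0 := by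
  have hs : slice i (siteOp j B (lp.single 2 c 1)) a =
      (if ∀ l, l ≠ i → l ≠ j → a l = c l then B (lp.single 2 (c j) 1) (a j) else 0) •
        (lp.single 2 (c i) 1 : Hilb (ι i)) := by
    refine hilb_ext fun t => ?_
    change siteOp j B (lp.single 2 c 1) (Function.update a i t) = _
    rw [siteOp_single, Function.update_of_ne hij.symm, lp.coeFn_smul, Pi.smul_apply,
      single_one_apply, smul_eq_mul, mul_ite, mul_one, mul_zero]
    have hiff : (∀ l, l ≠ j → Function.update a i t l = c l) ↔
        t = c i ∧ ∀ l, l ≠ i → l ≠ j → a l = c l := by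
      constructor
      · intro h
        refine ⟨by simpa using h i hij, fun l hli hlj => ?_⟩
        simpa [Function.update_of_ne hli] using h l hlj
      · rintro ⟨h1, h2⟩ l hl
        by_cases hli : l = i
        · subst hli; simpa using h1
        · rw [Function.update_of_ne hli]; exact h2 l hli hl
    by_cases h1 : t = c i <;> by_cases h2 : ∀ l, l ≠ i → l ≠ j → a l = c l
    · rw [if_pos (hiff.2 ⟨h1, h2⟩), if_pos h1, if_pos h2]
    · rw [if_neg (fun h => h2 (hiff.1 h).2), if_pos h1, if_neg h2]
    · rw [if_neg (fun h => h1 (hiff.1 h).1), if_neg h1]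
    · rw [if_neg (fun h => h1 (hiff.1 h).1), if_neg h1]
  rw [siteOp_apply, hs, map_smul, lp.coeFn_smul, Pi.smul_apply, smul_eq_mul]
  split_ifs
  · exact mul_comm _ _
  · exact zero_mul _

theorem siteOp_commute {i j : Fin n} (hij : i ≠ j) (A : Hilb (ι i) →L[ℂ] Hilb (ι i))
    (B : Hilb (ι j) →L[ℂ] Hilb (ι j)) : Commute (siteOp i A) (siteOp j B) := by
  have : ∀ i, DecidableEq (ι i) := fun _ => Classical.decEq _
  refine ext_basis fun c => hilb_ext fun a => ?_
  rw [mul_apply_eq_comp, mul_apply_eq_comp, siteOp_siteOp_single hij,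
    siteOp_siteOp_single hij.symm]
  refine if_congr ⟨fun h l h1 h2 => h l h2 h1, fun h l h1 h2 => h l h2 h1⟩ (mul_comm _ _) rfl

theorem siteOp_symmetric (j : Fin n) {A : Hilb (ι j) →L[ℂ] Hilb (ι j)}
    (hA : A.toLinearMap.IsSymmetric) : (siteOp j A).toLinearMap.IsSymmetric := by
  have : ∀ i, DecidableEq (ι i) := fun _ => Classical.decEq _
  have hadj : (siteOp j A).adjoint = siteOp j A := by
    refine ext_basis fun c => hilb_ext fun a => ?_
    have h1 : ((siteOp j A).adjoint (lp.single 2 c 1)) a =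
        inner ℂ (siteOp j A (lp.single 2 a 1)) (lp.single 2 c 1 : Hilb (∀ i, ι i)) := by
      rw [← ContinuousLinearMap.adjoint_inner_right, lp.inner_single_left]
      simp
    rw [h1, lp.inner_single_right, siteOp_single, siteOp_single]
    by_cases h : ∀ i, i ≠ j → a i = c i
    · rw [if_pos h, if_pos fun i hi => (h i hi).symm]
      have h2 := hA (lp.single 2 (a j) 1) (lp.single 2 (c j) 1)
      rw [lp.inner_single_left, lp.inner_single_right] at h2
      simpa using h2
    · rw [if_neg h, if_neg fun h' => h fun i hi => (h' i hi).symm]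
      simp
  intro f g
  change inner ℂ (siteOp j A f) g = inner ℂ f (siteOp j A g)
  rw [← ContinuousLinearMap.adjoint_inner_right, hadj]

end Local

/-! ### Two-outcome measurements -/

section Measurement

variable {H : Type*} [NormedAddCommGroup H] [InnerProductSpace ℂ H] 

/-- The observable `E - F` of a two-outcome measurement is a contraction. -/
theorem observable_contraction {E F : H →L[ℂ] H} (hE : E.IsPositive) (hF : F.IsPositive)
    (h : E + F = 1) (φ : H) : ‖(E - F) φ‖ ≤ ‖φ‖ := by
  have hs : ∀ (T : H →L[ℂ] H), T.IsPositive → ∀ x y, inner ℂ (T x) y = inner ℂ x (T y) :=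
    fun T hT x y => hT.inner_left_eq_inner_right x y
  have happ : E φ + F φ = φ := by
    rw [← add_apply, h, one_apply_eq_self]
  have hEF : ∀ x, F x = x - E x := fun x => by
    rw [eq_sub_iff_add_eq', ← add_apply, h, one_apply_eq_self]
  -- As F = 1 − E commutes with E, one has EF = EF(E + F) = EFE + FEF, a sum of positive operators.
  have key : 0 ≤ RCLike.re (inner ℂ (E φ) (F φ)) := by
    have h1 : inner ℂ (E φ) (F φ) = inner ℂ (F (E φ)) (E φ) + inner ℂ (E (F φ)) (F φ) := by
      have h2 : inner ℂ (F (E φ)) (E φ) = inner ℂ (E φ) (E (F φ)) := by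
        rw [hs F hF]
        congr 1
        rw [hEF (E φ), hEF φ, map_sub]
      rw [h2, hs E hE (F φ) (F φ)]
      have h3 : inner ℂ (E φ) (F φ) = inner ℂ φ (E (F φ)) := hs E hE φ (F φ)
      rw [h3, ← inner_add_left, happ]
    rw [h1, map_add]
    exact add_nonneg (hF.re_inner_nonneg_left _) (hE.re_inner_nonneg_left _)
  have h4 : ‖φ‖ ^ 2 = ‖(E - F) φ‖ ^ 2 + 4 * RCLike.re (inner ℂ (E φ) (F φ)) := by
    rw [sub_apply, @norm_sub_sq ℂ]
    conv_lhs => rw [← happ]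
    rw [@norm_add_sq ℂ]
    ring
  refine le_of_sq_le_sq ?_ (norm_nonneg _)
  linarith

end Measurement

/-! ### Expansion of the output distribution -/

theorem sum_prod_ofFn {R κ : Type*} [Ring R] [Fintype κ] [DecidableEq κ] {n : ℕ}
    (F : Fin n → κ → R) :
    ∑ m : Fin n → κ, (List.ofFn fun j => F j (m j)).prod =
      (List.ofFn fun j => ∑ c, F j c).prod := by
  induction n with
  | zero => simp
  | succ n ih =>
    rw [← (Fin.consEquiv fun _ => κ).sum_comp, Fintype.sum_prod_type]
    simp only [Fin.consEquiv, Equiv.coe_fn_mk, List.ofFn_succ, List.prod_cons, Fin.cons_zero,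
      Fin.cons_succ]
    rw [← ih, Finset.sum_mul]
    exact Finset.sum_congr rfl fun c _ => by rw [Finset.mul_sum]

/-- The sign of a bit. -/
def sgn (c : ZMod 2) : ℂ := if c = 0 then 1 else -1

theorem sgn_add (c d : ZMod 2) : sgn (c + d) = sgn c * sgn d := by
  have two : ∀ z : ZMod 2, z = 0 ∨ z = 1 := by decide
  have h0 : (1 : ZMod 2) + 1 = 0 := by decide
  rcases two c with rfl | rfl <;> rcases two d with rfl | rfl <;> simp [sgn, h0]

theorem sgn_sum {κ : Type*} (s : Finset κ) (m : κ → ZMod 2) :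
    sgn (∑ j ∈ s, m j) = ∏ j ∈ s, sgn (m j) := by
  classical
  induction s using Finset.induction_on with
  | empty => simp [sgn]
  | insert j s hj ih => rw [Finset.sum_insert hj, Finset.prod_insert hj, sgn_add, ih]

theorem norm_sgn (c : ZMod 2) : ‖sgn c‖ = 1 := by
  unfold sgn; split_ifs <;> simp

theorem prod_ofFn_smul {R : Type*} [Ring R] [Algebra ℂ R] {n : ℕ} (c : Fin n → ℂ)
    (F : Fin n → R) :
    (List.ofFn fun j => c j • F j).prod = (∏ j, c j) • (List.ofFn F).prod := by
  induction n with
  | zero => simp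
  | succ n ih => simp [List.ofFn_succ, Fin.prod_univ_succ, ih, smul_smul, mul_comm]

/-- Fourier expansion of the parity condition: its indicator is (1 + (−1)^{c + ∑ m})/2, and each of
the two terms factors over the sites. -/
theorem half_sum_signs {R : Type*} [Ring R] [Algebra ℂ R] {n : ℕ} (F : Fin n → ZMod 2 → R)
    (c : ZMod 2) :
    (2 : ℂ) • ∑ m : Fin n → ZMod 2 with ∑ j, m j = c, (List.ofFn fun j => F j (m j)).prod =
      (List.ofFn fun j => F j 0 + F j 1).prod +
        sgn c • (List.ofFn fun j => F j 0 - F j 1).prod := by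
  have h1 := sum_prod_ofFn F
  have h2 := sum_prod_ofFn fun j d => sgn d • F j d
  simp only [prod_ofFn_smul, ← sgn_sum] at h2
  have hz : ∀ G : ZMod 2 → R, ∑ d, G d = G 0 + G 1 := fun G => Fin.sum_univ_two G
  have h0 : sgn 0 = 1 := by simp [sgn]
  have h1' : sgn 1 = -1 := by simp [sgn]
  simp only [hz, h0, h1', one_smul, neg_smul, ← sub_eq_add_neg] at h1 h2
  rw [← h1, ← h2, Finset.smul_sum (r := sgn c), ← Finset.sum_add_distrib, Finset.sum_filter,
    Finset.smul_sum]
  refine Finset.sum_congr rfl fun m _ => ?_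
  have two : ∀ z : ZMod 2, z = 0 ∨ z = 1 := by decide
  split_ifs with h
  · rw [h, smul_smul, ← sgn_add, CharTwo.add_self_eq_zero, h0, one_smul, two_smul]
  · have : sgn c * sgn (∑ j, m j) = -1 := by
      rw [← sgn_add]
      have key : ∀ y z : ZMod 2, y ≠ z → z + y = 1 := by decide
      rw [key _ _ h, h1']
    rw [smul_smul, this, neg_smul, one_smul, add_neg_cancel, smul_zero]

/-! ### Deterministic computations -/

namespace Protocol

variable {k n : ℕ} (π : Protocol.{u} k n)

/-- The observable of a site that is sent a bit. -/
def observable (j : Fin n) (s : ZMod 2) : Hilb (π.ι j) →L[ℂ] Hilb (π.ι j) :=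
  π.E j s 0 - π.E j s 1

theorem effect_add (j : Fin n) (s : ZMod 2) : π.E j s 0 + π.E j s 1 = 1 :=
  (Fin.sum_univ_two (fun m => π.E j s m)).symm.trans (π.E_sum j s)

/-- The observables of the sites, as operators of the joint space that depend on the input. -/
def family : SiteFamily (Hilb (∀ j, π.ι j)) (Fin n) (Fin k → ZMod 2) where
  op j x := siteOp j (π.observable j (π.setting x j))
  contraction j x φ := by
    have h : ‖π.observable j (π.setting x j)‖ ≤ 1 :=
      ContinuousLinearMap.opNorm_le_bound _ zero_le_one fun f => by
        rw [one_mul]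
        exact observable_contraction (π.E_pos j _ 0) (π.E_pos j _ 1) (π.effect_add j _) f
    refine (ContinuousLinearMap.le_of_opNorm_le _ ((norm_siteOp_le _ _).trans h) φ).trans ?_
    rw [one_mul]
  symmetric j x := siteOp_symmetric j
    ((π.E_pos j _ 0).isSymmetric.sub (π.E_pos j _ 1).isSymmetric)
  comm _ _ hij _ _ := siteOp_commute hij _ _

theorem joint_eq (x : Fin k → ZMod 2) :
    π.family.joint x = (List.ofFn fun j => π.family.op j x).prod := by
  have h := Finset.noncommProd_toFinset (List.finRange n) (fun j => π.family.op j x)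
    (fun i _ j _ hij => π.family.comm i j hij x x) (List.nodup_finRange n)
  rw [List.ofFn_eq_map, ← h]
  exact Finset.noncommProd_congr (by ext; simp) (fun _ _ => rfl) _

/-- In `half_sum_signs` the first product is 1 because effects sum to 1, and the second is the joint
observable. -/
theorem outputProb_eq (x : Fin k → ZMod 2) (c : ZMod 2) :
    2 * π.outputProb x c = 1 + RCLike.re (inner ℂ (sgn c • π.ψ) (π.family.joint x π.ψ)) := by
  have h := half_sum_signs (fun j m => siteOp j (π.E j (π.setting x j) m)) c
  have h1 : ∀ j, siteOp j (π.E j (π.setting x j) 0) + siteOp j (π.E j (π.setting x j) 1) = 1 :=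
    fun j => by rw [← siteOp_add, effect_add, siteOp_one]
  have h2 : ∀ j, siteOp j (π.E j (π.setting x j) 0) - siteOp j (π.E j (π.setting x j) 1) =
    π.family.op j x := fun j => rfl
  simp only [h1, h2, ← joint_eq] at h
  have h3 := congrArg (fun T : Hilb (∀ j, π.ι j) →L[ℂ] Hilb (∀ j, π.ι j) =>
    RCLike.re (inner ℂ π.ψ (T π.ψ))) h
  have hone : (List.ofFn fun _ : Fin n => (1 : Hilb (∀ j, π.ι j) →L[ℂ] Hilb (∀ j, π.ι j))).prod
      = 1 := List.prod_eq_one fun T hT => by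
    obtain ⟨_, h⟩ := (List.mem_ofFn' _ _).1 hT
    exact h.symm
  have hsgn : (starRingEnd ℂ) (sgn c) = sgn c := by unfold sgn; split_ifs <;> simp
  have hprob : π.outputProb x c = RCLike.re (inner ℂ π.ψ
      ((∑ m : Fin n → ZMod 2 with ∑ j, m j = c,
        (List.ofFn fun j => siteOp j (π.E j (π.setting x j) (m j))).prod) π.ψ)) := by
    rw [sum_apply, inner_sum, map_sum]
    rfl
  have hre : ∀ z : ℂ, RCLike.re ((2 : ℂ) * z) = 2 * RCLike.re z := fun z => by simp
  rw [hprob, ← hre, ← inner_smul_right]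
  refine h3.trans ?_
  simp only [hone, add_apply, one_apply_eq_self, smul_apply]
  rw [inner_add_right, map_add, inner_smul_right, inner_smul_left, hsgn, inner_self_eq_norm_sq,
    π.norm_ψ, one_pow]

theorem re_inner_le (x : Fin k → ZMod 2) (c : ZMod 2) :
    RCLike.re (inner ℂ (sgn c • π.ψ) (π.family.joint x π.ψ)) ≤ 1 := by
  refine (re_inner_le_norm _ _).trans ?_
  rw [norm_smul, norm_sgn, π.norm_ψ, one_mul, one_mul]
  exact (π.family.joint_mem x π.ψ).trans π.norm_ψ.le

variable {π}

/-- In a deterministic computation the state is a common eigenvector of the joint observables. -/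
theorem joint_apply {f : (Fin k → ZMod 2) → ZMod 2} (h : π.meanSuccess f = 1)
    (x : Fin k → ZMod 2) : π.family.joint x π.ψ = sgn (f x) • π.ψ := by
  have hle : ∀ y ∈ Finset.univ, π.outputProb y (f y) ≤ 1 := fun y _ => by
    have h1 := π.outputProb_eq y (f y)
    have h2 := π.re_inner_le y (f y)
    linarith
  have hsum : ∑ y : Fin k → ZMod 2, π.outputProb y (f y) = ∑ _y : Fin k → ZMod 2, (1 : ℝ) := by
    have h2 : (2 : ℝ) ^ k ≠ 0 := by positivity
    unfold meanSuccess at h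
    rw [one_div, inv_mul_eq_iff_eq_mul₀ h2] at h
    rw [h]
    simp
  -- A mean of numbers at most 1 equals 1 only if all of them do.
  have hx := (Finset.sum_eq_sum_iff_of_le hle).1 hsum x (Finset.mem_univ x)
  have hre := π.outputProb_eq x (f x)
  rw [hx] at hre
  have hn : ‖π.family.joint x π.ψ‖ ^ 2 ≤ 1 :=
    pow_le_one₀ (norm_nonneg _) ((π.family.joint_mem x π.ψ).trans π.norm_ψ.le)
  -- Equality case of Cauchy–Schwarz: the real part of the inner product is 1 between vectors of
  -- norm at most 1.
  have hd : ‖sgn (f x) • π.ψ - π.family.joint x π.ψ‖ ^ 2 ≤ 0 := by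
    rw [@norm_sub_sq ℂ, norm_smul, norm_sgn, π.norm_ψ]
    linarith
  have hz := pow_eq_zero_iff (two_ne_zero) |>.1 (le_antisymm hd (sq_nonneg _))
  exact (sub_eq_zero.1 (norm_eq_zero.1 hz)).symm

theorem setting_eq (j : Fin n) (x : Fin k → ZMod 2) :
    π.setting x j = π.P j ⬝ᵥ x + π.setting 0 j := by
  simp [setting, Matrix.mulVec]

end Protocol

/-! ### Linear functionals on bit strings -/

theorem exists_dotProduct_eq_one {k : ℕ} {q : Fin k → ZMod 2} (hq : q ≠ 0) :
    ∃ v, q ⬝ᵥ v = 1 := by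
  obtain ⟨i, hi⟩ := Function.ne_iff.1 hq
  have two : ∀ z : ZMod 2, z ≠ 0 → z = 1 := by decide
  exact ⟨Pi.single i 1, by rw [dotProduct_single, mul_one]; exact two _ hi⟩

theorem add_add_self {k : ℕ} (x u : Fin k → ZMod 2) : x + u + u = x := by
  funext i
  simp [add_assoc, CharTwo.add_self_eq_zero]

/-- A functional that differs from `q` and agrees with it at some point that `q` does not annihilate
is balanced on the kernel of `q`. -/
theorem balanced_on_ker {k : ℕ} {p q : Fin k → ZMod 2} (hpq : p ≠ q) {v : Fin k → ZMod 2}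
    (hp : p ⬝ᵥ v = 1) (hq : q ⬝ᵥ v = 1) (t : ZMod 2) :
    ∑ x : Fin k → ZMod 2 with q ⬝ᵥ x = 0, (1 - 2 * ((p ⬝ᵥ x + t).val : ℤ)) = 0 := by
  obtain ⟨w, hw⟩ := exists_dotProduct_eq_one (sub_ne_zero.2 hpq)
  rw [sub_dotProduct] at hw
  -- Where p and q differ, either p is 1 and q is 0, or adding v interchanges the values.
  -- Translation by u then preserves ker q and flips p.
  obtain ⟨u, hpu, hqu⟩ : ∃ u, p ⬝ᵥ u = 1 ∧ q ⬝ᵥ u = 0 := by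
    have key : ∀ a b : ZMod 2, a - b = 1 → (a = 1 ∧ b = 0) ∨ (a + 1 = 1 ∧ b + 1 = 0) := by decide
    rcases key _ _ hw with h | h
    · exact ⟨w, h⟩
    · exact ⟨w + v, by rw [dotProduct_add, hp]; exact h.1, by rw [dotProduct_add, hq]; exact h.2⟩
  refine Finset.sum_involution (fun x _ => x + u) ?_ ?_ ?_ ?_
  · intro x _
    have key : ∀ z : ZMod 2, (1 - 2 * (z.val : ℤ)) + (1 - 2 * ((z + 1).val : ℤ)) = 0 := by decide
    rw [dotProduct_add, hpu, add_right_comm]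
    exact key _
  · intro x _ _ h
    rw [add_eq_left] at h
    rw [h, dotProduct_zero] at hpu
    exact zero_ne_one hpu
  · intro x hx
    rw [Finset.mem_filter] at hx ⊢
    exact ⟨Finset.mem_univ _, by rw [dotProduct_add, hx.2, hqu, add_zero]⟩
  · exact fun x _ => add_add_self x u

/-- Translation by v maps ker q onto its complement. -/
theorem sum_eq_sum_ker {k : ℕ} {M : Type*} [AddCommMonoid M] (q : Fin k → ZMod 2)
    {v : Fin k → ZMod 2} (hv : q ⬝ᵥ v = 1) (g : (Fin k → ZMod 2) → M) :
    ∑ x, g x = ∑ x : Fin k → ZMod 2 with q ⬝ᵥ x = 0, (g x + g (x + v)) := by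
  rw [Finset.sum_add_distrib, ← Finset.sum_filter_add_sum_filter_not Finset.univ
    (fun x => q ⬝ᵥ x = 0)]
  congr 1
  have key : ∀ z : ZMod 2, (¬ z + 1 = 0) ↔ z = 0 := by decide
  refine (Finset.sum_bij (fun x _ => x + v) ?_ ?_ ?_ fun _ _ => rfl).symm
  · intro x hx
    rw [Finset.mem_filter] at hx ⊢
    exact ⟨Finset.mem_univ _, by rw [dotProduct_add, hv, key]; exact hx.2⟩
  · exact fun _ _ _ _ h => add_right_cancel h
  · intro y hy
    rw [Finset.mem_filter] at hy
    have hvv := add_add_self y v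
    refine ⟨y + v, ?_, hvv⟩
    rw [Finset.mem_filter]
    refine ⟨Finset.mem_univ _, ?_⟩
    rw [← key, ← hv, ← dotProduct_add, hvv]
    exact hy.2

/-! ### Every nonzero parity is needed; the bound for NAND -/

/-- In a deterministic computation of a function of odd weight every parity of the input is sent to
some site. -/
theorem exists_row {k n : ℕ} {π : Protocol.{u} k n} {f : (Fin k → ZMod 2) → ZMod 2}
    (h : π.meanSuccess f = 1) (hf : ∑ x, f x = 1) {q : Fin k → ZMod 2} (hq : q ≠ 0) :
    ∃ j, π.P j = q := by
  by_contra! hne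
  obtain ⟨v, hv⟩ := exists_dotProduct_eq_one hq
  have hψ := Protocol.joint_apply h
  have hc : ∀ x, ‖sgn (f x)‖ = 1 := fun x => norm_sgn _
  let s : Finset (Fin k → ZMod 2) := {x | q ⬝ᵥ x = 0}
  -- Each input occurs exactly once in this list, next to its translate by v.
  let l := s.toList.flatMap fun x => [x, x + v]
  have hfix : π.family.total l π.ψ = π.ψ := by
    refine π.family.total_fix fun j => ?_
    obtain ⟨O, b, hO, hb, hb2⟩ := SiteFamily.exists_perm hψ hc j
    have hs : ∀ x y, π.setting x j = π.setting y j → b x = b y := by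
      intro x y hxy
      ext1 o
      apply Subtype.ext
      rw [hb, hb]
      change siteOp j (π.observable j (π.setting x j)) o = siteOp j (π.observable j _) o
      rw [hxy]
    have h1 := alternating_prod_eq_one b hb2 (fun x => π.setting x j) hs
      (dotProductEquiv (ZMod 2) (Fin k) (π.P j)).toAddMonoidHom
      (fun x => Protocol.setting_eq j x) v s.toList (by
        intro hpv
        have two : ∀ z : ZMod 2, z ≠ 0 → z = 1 := by decide
        rw [Finset.sum_map_toList]
        exact (Finset.sum_congr rfl fun x _ => congrArg (fun z : ZMod 2 => 1 - 2 * (z.val : ℤ))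
          (Protocol.setting_eq j x)).trans (balanced_on_ker (hne j) (two _ hpv) hv _))
    have h2 := SiteFamily.word_eq_of_perm hb l ⟨π.ψ, hO⟩
    rw [h1] at h2
    exact h2.symm
  have hsign : ∀ l' : List (Fin k → ZMod 2),
      (l'.map π.family.joint).prod π.ψ = sgn ((l'.map f).sum) • π.ψ := by
    intro l'
    induction l' with
    | nil => simp [sgn]
    | cons x l' ih =>
      rw [List.map_cons, List.prod_cons, mul_apply_eq_comp, ih, map_smul, hψ, smul_smul,
        List.map_cons, List.sum_cons, sgn_add, mul_comm]
  have hlsum : (l.map f).sum = 1 := by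
    rw [← hf, sum_eq_sum_ker q hv, ← Finset.sum_map_toList]
    change ((s.toList.flatMap _).map f).sum = (s.toList.map _).sum
    induction s.toList with
    | nil => rfl
    | cons x l' ih => simp [ih, add_assoc]
  rw [SiteFamily.total_eq, hsign, hlsum] at hfix
  have h1 : sgn 1 = -1 := by simp [sgn]
  rw [h1, neg_smul, one_smul] at hfix
  have h0 : (2 : ℂ) • π.ψ = 0 := by
    rw [two_smul]
    nth_rw 1 [← hfix]
    exact neg_add_cancel _
  have h0 : π.ψ = 0 := (smul_eq_zero.1 h0).resolve_left two_ne_zero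
  have := π.norm_ψ
  rw [h0, norm_zero] at this
  exact zero_ne_one this

/-- The products sum to (0 + 1)^k = 1, and the constant 1 contributes 2^k = 0. For k = 0 the latter
fails and the weight is even. -/
theorem sum_nand {k : ℕ} (hk : k ≠ 0) : ∑ x, nand k x = 1 := by
  unfold nand
  rw [Finset.sum_add_distrib]
  have h1 : ∑ t : ZMod 2, t = 1 := by decide
  have h3 := Finset.prod_univ_sum (fun _ : Fin k => (Finset.univ : Finset (ZMod 2)))
    (fun _ t => t)
  rw [Fintype.piFinset_univ] at h3
  have h2 : (2 : ZMod 2) = 0 := by decide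
  rw [← h3]
  simp [h1, h2, hk]

theorem sites_of_performs_nand {k n : ℕ} (h : Performs.{u} n (nand k)) : 2 ^ k - 1 ≤ n := by
  obtain ⟨π, hπ⟩ := h
  rcases eq_or_ne k 0 with rfl | hk
  · simp
  have hsub : Finset.univ.erase (0 : Fin k → ZMod 2) ⊆ Finset.univ.image π.P := by
    intro q hq
    obtain ⟨j, hj⟩ := exists_row hπ (sum_nand hk) (Finset.ne_of_mem_erase hq)
    exact Finset.mem_image.2 ⟨j, Finset.mem_univ j, hj⟩
  have hcard := (Finset.card_le_card hsub).trans Finset.card_image_le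
  rw [Finset.card_erase_of_mem (Finset.mem_univ _)] at hcard
  simpa using hcard

/-! ### A Turing machine for functions of the conjunction -/

section ConjunctionMachine

open Turing

/-- The alphabets of the input and the output stack. -/
abbrev Alphabet (Γ₁ : Type) (b : Bool) : Type := cond b Γ₁ (ZMod 2)

/-- Write a word on the output stack, its head on top. -/
def pushes {Γ₁ : Type} :
    List Γ₁ → TM2.Stmt (Alphabet Γ₁) Unit (Bool × Bool) → TM2.Stmt (Alphabet Γ₁) Unit (Bool × Bool)
  | [], q => q
  | g :: L, q => pushes L (.push true (fun _ => g) q)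

/-- The machine that reads its input and then writes `o true` if all bits were `1`, and `o false`
otherwise. The state is the conjunction of the bits that were read, and whether the input is
exhausted. -/
def conjMachine (Γ₁ : Type) (o : Bool → List Γ₁) : FinTM2 where
  K := Bool
  k₀ := false
  k₁ := true
  Γ := Alphabet Γ₁
  Λ := Unit
  main := ()
  σ := Bool × Bool
  initialState := (true, false)
  Γk₀Fin := inferInstanceAs (Fintype (ZMod 2))
  m _ := .pop false (fun v t => t.elim (v.1, true) fun z : ZMod 2 => (v.1 && decide (z = 1), false))
    (.branch (fun v => v.2)
      (.branch (fun v => v.1)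
        -- A halting configuration must carry the initial state, hence the reset.
        (pushes (o true) (.load (fun _ => (true, false)) .halt))
        (pushes (o false) (.load (fun _ => (true, false)) .halt)))
      (.goto fun _ => ()))

variable {Γ₁ : Type}

/-- The contents of the input and the output stack. -/
def contents (i : List (ZMod 2)) (r : List Γ₁) : ∀ b : Bool, List (Alphabet Γ₁ b)
  | false => i
  | true => r

theorem stepAux_pushes (L : List Γ₁) (q : TM2.Stmt (Alphabet Γ₁) Unit (Bool × Bool))
    (v : Bool × Bool) (i : List (ZMod 2)) (r : List Γ₁) :
    TM2.stepAux (pushes L q) v (contents i r) = TM2.stepAux q v (contents i (L ++ r)) := by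
  induction L generalizing q with
  | nil => rfl
  | cons g L ih =>
    rw [pushes, ih, TM2.stepAux]
    congr 1
    funext b
    cases b <;> rfl

variable (o : Bool → List Γ₁)

theorem update_contents (i i' : List (ZMod 2)) (r : List Γ₁) :
    Function.update (contents i r) false i' = contents i' r := by
  funext b
  cases b <;> rfl

theorem conjMachine_step_cons (c : Bool) (z : ZMod 2) (i : List (ZMod 2)) :
    (conjMachine Γ₁ o).step ⟨some (), (c, false), contents (z :: i) []⟩ =
      some ⟨some (), (c && decide (z = 1), false), contents i []⟩ := by
  exact congrArg (fun S => some (⟨some (), (c && decide (z = 1), false), S⟩ :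
    (conjMachine Γ₁ o).Cfg)) (update_contents (z :: i) i [])

theorem conjMachine_step_nil (c : Bool) :
    (conjMachine Γ₁ o).step ⟨some (), (c, false), contents [] []⟩ =
      some ⟨none, (true, false), contents [] (o c)⟩ := by
  have h : ∀ c : Bool, TM2.stepAux (pushes (o c) (.load (fun _ => (true, false)) .halt)) (c, true)
      (contents [] []) = ⟨none, (true, false), contents [] (o c)⟩ := by
    intro c
    rw [stepAux_pushes, List.append_nil]
    rfl
  refine (congrArg some ?_).trans (congrArg some (h c))
  have h2 := update_contents (Γ₁ := Γ₁) [] [] []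
  cases c
  · exact congrArg (TM2.stepAux (pushes (o false) (.load (fun _ => (true, false)) .halt))
      (false, true)) h2
  · exact congrArg (TM2.stepAux (pushes (o true) (.load (fun _ => (true, false)) .halt))
      (true, true)) h2

/-- One step per bit, and one more that finds the input stack empty and writes the whole output at
once. -/
theorem conjMachine_iterate (i : List (ZMod 2)) (c : Bool) :
    (flip bind (conjMachine Γ₁ o).step)^[i.length + 1]
        (some ⟨some (), (c, false), contents i []⟩) =
      some ⟨none, (true, false), contents [] (o (c && i.all fun z => decide (z = 1)))⟩ := by
  induction i generalizing c with
  | nil =>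
    rw [List.all_nil, Bool.and_true]
    exact conjMachine_step_nil o c
  | cons z i ih =>
    rw [List.length_cons, Function.iterate_succ_apply, List.all_cons, ← Bool.and_assoc, ← ih]
    exact congrArg _ (conjMachine_step_cons o c z i)

theorem initList_conjMachine (i : List (ZMod 2)) :
    initList (conjMachine Γ₁ o) i = ⟨some (), (true, false), contents i []⟩ := by
  refine congrArg (TM2.Cfg.mk (some ()) (true, false)) ?_
  funext b
  cases b <;> rfl

theorem haltList_conjMachine (r : List Γ₁) :
    haltList (conjMachine Γ₁ o) r = ⟨none, (true, false), contents [] r⟩ := by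
  refine congrArg (TM2.Cfg.mk none (true, false)) ?_
  funext b
  cases b <;> rfl

/-- Whatever depends only on the conjunction of the input bits is computable in polynomial time. -/
def polyTimeOfConj {β : Type} (enc : β → List Γ₁) (g : BitString → β)
    (h : ∀ x, enc (g x) = o (x.word.all fun z => decide (z = 1))) :
    TM2ComputableInPolyTime BitString.word enc g where
  tm := conjMachine Γ₁ o
  inputAlphabet := Equiv.refl _
  outputAlphabet := Equiv.refl _
  time := Polynomial.X + 1
  outputsFun x :=
    { steps := x.word.length + 1
      evals_in_steps := by
        have key := conjMachine_iterate o x.word true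
        rw [← initList_conjMachine, ← haltList_conjMachine, Bool.true_and, ← h] at key
        exact (congrArg (fun i => (flip bind (conjMachine Γ₁ o).step)^[x.word.length + 1]
            (some (initList (conjMachine Γ₁ o) i))) (List.map_id x.word)).trans
          (key.trans (congrArg (fun r => some (haltList (conjMachine Γ₁ o) r))
            (List.map_id (enc (g x))).symm))
      steps_le_m := by simp }

end ConjunctionMachine

theorem nand_eq (x : BitString) :
    nand x.1 x.2 = if x.word.all fun z => decide (z = 1) then 0 else 1 := by
  obtain ⟨k, x⟩ := x
  have h0 : (1 : ZMod 2) + 1 = 0 := by decide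
  have two : ∀ z : ZMod 2, z ≠ 1 → z = 0 := by decide
  simp only [BitString.word, nand, List.all_eq_true, List.mem_ofFn', Set.mem_range,
    forall_exists_index, forall_apply_eq_imp_iff, decide_eq_true_eq]
  split_ifs with h
  · simp [h, h0]
  · push Not at h
    obtain ⟨i, hi⟩ := h
    rw [Finset.prod_eq_zero (Finset.mem_univ i) (two _ hi), zero_add]

theorem classicalPolyTime_nand : ClassicalPolyTime nand :=
  ⟨polyTimeOfConj (fun c => [if c then 0 else 1]) _ _ fun x => by rw [nand_eq]⟩

/-! ### Quantum circuits with a constant output -/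

theorem outputProb_one_qubit (L : List (Gate 1)) (c : ZMod 2) :
    QCircuit.outputProb ⟨0, L⟩ c =
      ‖(L.foldl (fun φ g => g.apply φ) (fun a => if a = 0 then 1 else 0) : QState 1)
        (fun _ => c)‖ ^ 2 := by
  change ∑ a : Fin 1 → ZMod 2 with a 0 = c,
    ‖(L.foldl (fun φ g => g.apply φ) (fun a => if a = 0 then 1 else 0) : QState 1) a‖ ^ 2 = _
  rw [Finset.sum_eq_single (fun _ : Fin 1 => c)]
  · intro b hb hne
    refine absurd (funext fun i => ?_) hne
    rw [Subsingleton.elim i (0 : Fin 1)]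
    exact (Finset.mem_filter.1 hb).2
  · intro h
    exact absurd (Finset.mem_filter.2 ⟨Finset.mem_univ (fun _ => c), (rfl : c = c)⟩) h

/-- The state of one qubit with given amplitudes. -/
def qubit (α β : ℂ) : QState 1 := fun a => if a 0 = 1 then β else α

theorem qubit_zero : (fun a => if a = 0 then 1 else 0 : QState 1) = qubit 1 0 := by
  funext a
  have two : ∀ z : ZMod 2, z = 0 ∨ z = 1 := by decide
  have ha : a = 0 ↔ a 0 = 0 := ⟨fun h => congrFun h 0, fun h => funext fun i => by
    rw [Subsingleton.elim i 0]; exact h⟩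
  rcases two (a 0) with h | h <;> simp [qubit, ha, h]

theorem had_qubit (α β : ℂ) : (Gate.had (0 : Fin 1)).apply (qubit α β) =
    qubit (1 / (Real.sqrt 2 : ℂ) * (α + β)) (1 / (Real.sqrt 2 : ℂ) * (α - β)) := by
  funext a
  by_cases h : a 0 = 1 <;> simp [Gate.apply, qubit, h, sub_eq_add_neg]

theorem tee_qubit (α β : ℂ) : (Gate.tee (0 : Fin 1)).apply (qubit α β) =
    qubit α (Complex.exp (Complex.I * (Real.pi / 4)) * β) := by
  funext a
  by_cases h : a 0 = 1 <;> simp [Gate.apply, qubit, h]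

theorem exp_quarter_pow : Complex.exp (Complex.I * (Real.pi / 4)) ^ 4 = -1 := by
  rw [← Complex.exp_nat_mul, ← Complex.exp_pi_mul_I]
  congr 1
  push_cast
  ring

/-- The circuit on one qubit that outputs `0`. -/
def zeroCircuit : QCircuit := ⟨0, []⟩

/-- The circuit on one qubit that outputs `1`: the NOT gate is `H T⁴ H`. -/
def oneCircuit : QCircuit :=
  ⟨0, [.had (0 : Fin 1), .tee (0 : Fin 1), .tee (0 : Fin 1), .tee (0 : Fin 1), .tee (0 : Fin 1),
    .had (0 : Fin 1)]⟩

theorem outputProb_zeroCircuit : zeroCircuit.outputProb 0 = 1 := by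
  rw [zeroCircuit, outputProb_one_qubit, qubit_zero]
  simp [qubit]

theorem outputProb_oneCircuit : oneCircuit.outputProb 1 = 1 := by
  rw [oneCircuit, outputProb_one_qubit, qubit_zero]
  simp only [List.foldl_cons, List.foldl_nil, had_qubit, tee_qubit]
  have hs : (Real.sqrt 2 : ℂ) * (Real.sqrt 2 : ℂ) = 2 := by
    rw [← Complex.ofReal_mul, Real.mul_self_sqrt (by norm_num)]
    norm_num
  have hs2 : (1 / (Real.sqrt 2 : ℂ)) * (1 / (Real.sqrt 2 : ℂ)) = 1 / 2 := by
    rw [div_mul_div_comm, hs, one_mul]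
  have he := exp_quarter_pow
  generalize 1 / (Real.sqrt 2 : ℂ) = r at *
  generalize Complex.exp (Complex.I * (Real.pi / 4)) = e at *
  -- The amplitude of |1⟩ after H T⁴ H is r²(1 − e⁴), with r² = 1/2 and e⁴ = −1.
  have hval : r * (r * (1 + 0) - e * (e * (e * (e * (r * (1 - 0)))))) = 1 := by
    linear_combination 2 * hs2 - r * r * he
  rw [hval]
  simp [qubit]

/-- The classical machine already knows the answer and picks one of two fixed error-free circuits,
so every ε ≥ 0 is allowed. -/
theorem quantumPolyTime_nand {ε : ℝ} (hε : 0 ≤ ε) : QuantumPolyTime ε nand := by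
  refine ⟨fun x => if x.word.all fun z => decide (z = 1) then zeroCircuit else oneCircuit,
    ⟨polyTimeOfConj (fun c => (if c then zeroCircuit else oneCircuit).encode) _ _ fun x => rfl⟩,
    fun x => ?_⟩
  rw [nand_eq]
  beta_reduce
  split_ifs
  · rw [outputProb_zeroCircuit]
    linarith
  · rw [outputProb_oneCircuit]
    linarith

/-! ### Polynomials grow more slowly than `2 ^ k` -/

theorem tendsto_polynomial_div_two_pow (p : Polynomial ℕ) :
    Filter.Tendsto (fun k : ℕ => ((p.eval k : ℕ) : ℝ) / 2 ^ k) Filter.atTop (nhds 0) := by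
  have h : ∀ k : ℕ, ((p.eval k : ℕ) : ℝ) / 2 ^ k =
      ∑ i ∈ Finset.range (p.natDegree + 1), (p.coeff i : ℝ) * ((k : ℝ) ^ i / 2 ^ k) := by
    intro k
    rw [Polynomial.eval_eq_sum_range]
    push_cast
    rw [Finset.sum_div]
    exact Finset.sum_congr rfl fun i _ => mul_div_assoc _ _ _
  simp only [h]
  refine (tendsto_finsetSum _ fun i _ => ?_ : Filter.Tendsto _ _
    (nhds (∑ i ∈ Finset.range (p.natDegree + 1), (0 : ℝ)))).trans (by simp)
  simpa using (tendsto_pow_const_div_const_pow_of_one_lt i (one_lt_two : (1 : ℝ) < 2)).const_mul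
    (p.coeff i : ℝ)

theorem exists_eval_lt_two_pow (p : Polynomial ℕ) : ∃ k : ℕ, p.eval k < 2 ^ k - 1 := by
  -- The added 1 absorbs the −1 in 2^k − 1.
  have h := (tendsto_polynomial_div_two_pow (p + 1)).eventually_lt_const
    (zero_lt_one : (0 : ℝ) < 1)
  obtain ⟨k, hk⟩ := h.exists
  rw [div_lt_one (by positivity)] at hk
  have hk' : (p + 1).eval k < 2 ^ k := by exact_mod_cast hk
  rw [Polynomial.eval_add, Polynomial.eval_one] at hk'
  exact ⟨k, by omega⟩

/-- Universal quantum computation is not achieved efficiently and deterministically. -/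
theorem not_universal {ε : ℝ} (hε : 0 ≤ ε) : ¬ Universal.{u} ε := by
  intro h
  obtain ⟨p, hp⟩ := h nand (quantumPolyTime_nand hε)
  obtain ⟨k, hk⟩ := exists_eval_lt_two_pow p
  obtain ⟨n, hn, hperf⟩ := hp k
  exact absurd (sites_of_performs_nand hperf) (hn.trans_lt hk).not_ge

end NMBQC

end

theorem corollary3p4p1 :
    NMBQC.ClassicalPolyTime NMBQC.nand ∧
    (∀ k n : ℕ, NMBQC.Performs.{u} n (NMBQC.nand k) → 2 ^ k - 1 ≤ n) ∧
    (∀ ε : ℝ, 0 ≤ ε → ¬ NMBQC.Universal.{u} ε) :=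
  ⟨NMBQC.classicalPolyTime_nand, fun _ _ => NMBQC.sites_of_performs_nand,
    fun _ => NMBQC.not_universal⟩
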